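/- **Notation.** For a topological space $X$ let $\mathcal P(X)$ be the set of probability measures with finite support on $X$. It carries the quotient topology, i.e. the finest topology for which all the maps $X^n\times\Delta^{n-1}\to\mathcal P(X)$, $(x,t)\mapsto\sum_{i=1}^n t_i\delta_{x_i}$, are continuous, where $\Delta^{n-1}=\{t\in[0,1]^n:\sum_i t_i=1\}$ and products are taken in compactly generated spaces; if $X$ is a metric space, $\mathcal P(X)_{\mathrm{LP}}$ denotes the same set with the topology of the Lévy–Prokhorov metric. For a continuous map $f:X\to Y$ let $\mathcal P_n(f)\subseteq\mathcal P(X)$ be the subspace of the measures whose support has at most $n$ points and lies in a single fiber of $f$, with the map $\mathcal P_n(f)\to Y$ that sends a measure to the point in whose fiber it is supported; $\mathcal P_n(f)_{\mathrm{LP}}$ is the same set as a subspace of $\mathcal P(X)_{\mathrm{LP}}$. The *analog* (respectively, for metric $X$, *distributional*) *sectional category* of $f$ is the least $n\ge 0$ such that $\mathcal P_{n+1}(f)\to Y$ (respectively $\mathcal P_{n+1}(f)_{\mathrm{LP}}\to Y$) admits a continuous section, and $\infty$ if there is none. The *analog category* $\mathrm{acat}(X)$ (respectively, for metric $X$, the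 *distributional category* $\mathrm{dcat}(X)$) is the analog (respectively distributional) sectional category of the evaluation map $\gamma\mapsto\gamma(1)$ from the space of paths $\gamma:[0,1]\to X$ with $\gamma(0)=x_0$ (with the compact-open topology, respectively the uniform metric) to $X$, where $x_0\in X$ is a base point. For a group $G$ let $BG$ be the geometric realization of the nerve of $G$. Since $BG$ is in general not metrizable, the distributional category of $G$ is understood as $\mathrm{dcat}(X)$ for a metric space $X$ homotopy equivalent to $BG$ (every CW complex is homotopy equivalent to a metrizable space). **Theorem 1.3.** For every finite group $G$, the analog and the distributional category of $G$ coincide: for every metric space $X$ that is homotopy equivalent to $BG$, and for all choices of the base points in $BG$ and in $X$, $$\mathrm{acat}(BG)=\mathrm{dcat}(X).$$ -/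

import Mathlib

open Topology CategoryTheory MeasureTheory

namespace AnalogCategory

noncomputable section

universe u v

/-! ### Finitely supported probability measures

`Convexity.StdSimplex ℝ X` is Mathlib's type of finitely supported functions `X →₀ ℝ` with nonnegative values
of total mass `1`; its element with weights `t` stands for the measure `∑ x, t x • δ_x`. -/

/-- The set `𝒫(X)` of probability measures with finite support on `X`. -/
abbrev FinProb (X : Type u) : Type u := Convexity.StdSimplex ℝ X

/-- The measure `∑ i, t i • δ_(x i)`, for points `x 1, …, x n` (not necessarily distinct) and
barycentric coordinates `t` (not necessarily nonzero). -/
def combination {X : Type u} {n : ℕ} (p : (Fin n → X) × stdSimplex ℝ (Fin n)) : FinProb X where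
  weights := ∑ i, Finsupp.single (p.1 i) ((p.2 : Fin n → ℝ) i)
  nonneg := Finset.sum_nonneg fun i _ => Finsupp.single_nonneg.2 (p.2.2.1 i)
  total := by
    rw [← Finsupp.sum_finsetSum_index (fun _ => rfl) (fun _ _ _ => rfl)]
    simp

/-- The measure `∑ x, t x • δ_x`. -/
def toProbabilityMeasure {X : Type u} [MeasurableSpace X] (μ : FinProb X) :
    ProbabilityMeasure X :=
  ⟨∑ x ∈ μ.weights.support, ENNReal.ofReal (μ.weights x) • Measure.dirac x, ⟨by
    have h : ∑ x ∈ μ.weights.support, μ.weights x = 1 := μ.total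
    simp only [Measure.coe_finsetSum, Finset.sum_apply, Measure.smul_apply, measure_univ,
      smul_eq_mul, mul_one]
    rw [← ENNReal.ofReal_sum_of_nonneg (fun x _ => μ.nonneg x), h, ENNReal.ofReal_one]⟩⟩

/-- The quotient topology on `𝒫(X)`: the finest topology for which all the maps
`Xⁿ × Δⁿ⁻¹ → 𝒫(X)` are continuous. The products are taken in compactly generated spaces, i.e. they
carry the `k`-ification `𝐤` of the product topology. As `X` and `𝐤 X` have the same compact subsets
with the same subspace topologies, the result is the same for `X` and for `𝐤 X`. -/
@[reducible] def quotientTopology (X : Type u) [TopologicalSpace X] : TopologicalSpace (FinProb X) :=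
  ⨆ n : ℕ, TopologicalSpace.coinduced
    (fun p : CompactCoherentification ((Fin n → X) × stdSimplex ℝ (Fin n)) =>
      combination ((CompactCoherentification.mk _).symm p)) inferInstance

/-- The topology of the Lévy–Prokhorov metric on `𝒫(X)`, for a metric space `X`. -/
@[reducible] def levyProkhorovTopology (X : Type u) [MetricSpace X] : TopologicalSpace (FinProb X) :=
  letI : MeasurableSpace X := borel X
  haveI : BorelSpace X := ⟨rfl⟩
  TopologicalSpace.induced
    (fun μ : FinProb X => LevyProkhorov.ofMeasure (toProbabilityMeasure μ)) inferInstance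

/-! ### Measures with fiberwise support and sectional categories -/

/-- The set `𝒫_n(f)` of measures with support of cardinality at most `n` that is contained in a
single fiber of `f`. -/
def FiberwiseProb {X : Type u} {Y : Type v} (n : ℕ) (f : X → Y) : Type u :=
  {μ : FinProb X // μ.weights.support.card ≤ n ∧ ∃ y, ∀ x ∈ μ.weights.support, f x = y}

/-- The map `𝒫_n(f) → Y` that sends a measure to the point in whose fiber it is supported. -/
def FiberwiseProb.proj {X : Type u} {Y : Type v} {n : ℕ} {f : X → Y} (μ : FiberwiseProb n f) : Y :=
  μ.2.2.choose

/-- `μ.proj` is the unique point in whose fiber `μ` is supported. -/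
theorem FiberwiseProb.proj_eq_iff {X : Type u} {Y : Type v} {n : ℕ} {f : X → Y}
    (μ : FiberwiseProb n f) (y : Y) :
    μ.proj = y ↔ ∀ x ∈ μ.1.weights.support, f x = y := by
  have h : ∀ x ∈ μ.1.weights.support, f x = μ.proj := μ.2.2.choose_spec
  constructor
  · rintro rfl
    exact h
  · intro hy
    obtain ⟨x, hx⟩ := μ.1.support_weights_nonempty
    rw [← h x hx, hy x hx]

/-- With `𝒫(X)` topologized by `τ`, the map `𝒫_n(f) → Y` admits a (continuous) section. -/
def HasSection {X : Type u} {Y : Type v} [TopologicalSpace Y] (τ : TopologicalSpace (FinProb X))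
    (n : ℕ) (f : X → Y) : Prop :=
  letI : TopologicalSpace (FiberwiseProb n f) := TopologicalSpace.induced Subtype.val τ
  ∃ s : Y → FiberwiseProb n f, Continuous s ∧ ∀ y, (s y).proj = y

/-- The least `n` such that `𝒫_{n+1}(f) → Y` admits a section, with `𝒫(X)` topologized by `τ`;
it is `⊤` if there is no such `n`. -/
def sectionalCategory {X : Type u} {Y : Type v} [TopologicalSpace Y]
    (τ : TopologicalSpace (FinProb X)) (f : X → Y) : ℕ∞ :=
  sInf {m : ℕ∞ | ∃ n : ℕ, m = n ∧ HasSection τ (n + 1) f}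

/-- The analog sectional category of `f : X → Y`. -/
def analogSectionalCategory {X : Type u} {Y : Type v} [TopologicalSpace X] [TopologicalSpace Y]
    (f : X → Y) : ℕ∞ :=
  sectionalCategory (quotientTopology X) f

/-- The distributional sectional category of `f : X → Y` with metric source. -/
def distributionalSectionalCategory {X : Type u} {Y : Type v} [MetricSpace X] [TopologicalSpace Y]
    (f : X → Y) : ℕ∞ :=
  sectionalCategory (levyProkhorovTopology X) f

/-! ### Analog and distributional category -/

/-- The space `(X, x₀)^([0,1], {0})` of paths in `X` that start at `x₀`, with the compact-open
topology (for metric `X`: with the uniform metric). -/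
abbrev PathsFrom {X : Type u} [TopologicalSpace X] (x₀ : X) : Type u :=
  {γ : C(unitInterval, X) // γ 0 = x₀}

/-- The evaluation map `(X, x₀)^([0,1], {0}) → X` at the end point. -/
def endpoint {X : Type u} [TopologicalSpace X] (x₀ : X) (γ : PathsFrom x₀) : X := γ.1 1

/-- The analog category of `X`, computed at the base point `x₀`. -/
def acat (X : Type u) [TopologicalSpace X] (x₀ : X) : ℕ∞ :=
  analogSectionalCategory (endpoint x₀)

/-- The distributional category of the metric space `X`, computed at the base point `x₀`. -/
def dcat (X : Type u) [MetricSpace X] (x₀ : X) : ℕ∞ :=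
  distributionalSectionalCategory (endpoint x₀)

/-- The classifying space `BG` of the discrete group `G`: the geometric realization of the nerve
of `G`, viewed as a category with one object. -/
abbrev ClassifyingSpace (G : Type u) [Group G] : TopCat.{u} :=
  SSet.toTop.{u}.obj (nerve (SingleObj G))

end

end AnalogCategory

/-!
Over a space `Y`, call a section of `𝒫_n(endpoint) → Y` *weak* if it is continuous for the weak
topology, the coarsest one that makes `μ ↦ μ(A)` lower semicontinuous for all open sets `A`. The
proof compares both sides of the theorem with weak sections.

For finitely supported measures on a metric space, the weak topology is the Lévy–Prokhorov topology
(`levyProkhorovTopology_eq_weakTopology`): closeness to `μ` only involves the finitely many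
thickenings of the subsets of the support of `μ`. On every space it is coarser than the quotient
topology (`quotientTopology_le_weakTopology`). Weak sections are invariant under homotopy
equivalence (`hasSection_weakTopology_of_homotopy`): paths are transported along the equivalence and
the homotopy, and the push-forward of measures along a family of maps is jointly continuous in the
weak sense. It remains to turn a weak section over `BG` into one that is continuous for the quotient
topology (`hasSection_quotientTopology_of_weakTopology`); only this step uses that `G` is finite.

Let `EG → BG` be the universal covering. A path in `BG` lifts to `EG`, and the lift ends on one of
the `|G|` points over the end point of the path. Conversely, the straight-line contraction of `EG`
provides a path in `BG`, a *ray*, for every point of `EG`. Replacing each path in the support of a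
measure by the ray that ends on the same sheet does not enlarge the supports, and the resulting
family is continuous for the quotient topology: over a simplex it is a combination of `|G|`
continuous families of rays, whose coefficients are lower semicontinuous with sum `1`, hence
continuous. These families on the simplices are compatible and glue to a map on the realization.

Instead of `EG`, the argument uses the space of functions `[0, 1) → G` with the topology of
convergence in measure. A point of `EG` with coordinates `t` in the simplex with vertices `v 0, …, v
k` gives the step function that takes the values `v i` on consecutive intervals of lengths `t i`.
Since `G` moves every function by distance `1`, the quotient map by `G` is a covering, and path
lifting is available without a study of the topology of `BG` (`exists_classifyingMap`).
-/

namespace AnalogCategory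

noncomputable section

universe u v w

/-! ### The weak topology on finitely supported measures -/

/-- The mass `μ(A)` that a finitely supported measure gives to a set. -/
def mass {X : Type u} (μ : FinProb X) (A : Set X) : ℝ :=
  μ.weights.sum fun x r => A.indicator (fun _ => r) x

theorem mass_eq_sum {X : Type u} (μ : FinProb X) (A : Set X) :
    mass μ A = ∑ x ∈ μ.weights.support, A.indicator μ.weights x :=
  Finset.sum_congr rfl fun x _ => by by_cases hx : x ∈ A <;> simp [hx]

theorem mass_mono_of_support {X : Type u} {μ : FinProb X} {A B : Set X}
    (h : ∀ x ∈ μ.weights.support, x ∈ A → x ∈ B) : mass μ A ≤ mass μ B := by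
  rw [mass_eq_sum, mass_eq_sum]
  refine Finset.sum_le_sum fun x hx => ?_
  by_cases hA : x ∈ A
  · simp [hA, h x hx hA]
  · simpa [hA] using Set.indicator_nonneg (fun y _ => μ.nonneg y) x

theorem mass_congr_of_support {X : Type u} {μ : FinProb X} {A B : Set X}
    (h : ∀ x ∈ μ.weights.support, x ∈ A ↔ x ∈ B) : mass μ A = mass μ B :=
  le_antisymm (mass_mono_of_support fun x hx => (h x hx).1)
    (mass_mono_of_support fun x hx => (h x hx).2)

theorem mass_nonneg {X : Type u} (μ : FinProb X) (A : Set X) : 0 ≤ mass μ A := by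
  rw [mass_eq_sum]
  exact Finset.sum_nonneg fun x _ => Set.indicator_nonneg (fun y _ => μ.nonneg y) x

theorem mass_map {X : Type u} {Y : Type v} (f : X → Y) (μ : FinProb X) (A : Set Y) :
    mass (Convexity.StdSimplex.map f μ) A = mass μ (f ⁻¹' A) := by
  unfold mass
  rw [Convexity.StdSimplex.weights_map, Finsupp.sum_mapDomain_index]
  · rfl
  · intro y; by_cases hy : y ∈ A <;> simp [hy]
  · intro y a b; by_cases hy : y ∈ A <;> simp [hy]

theorem mass_combination {X : Type u} {n : ℕ} (p : (Fin n → X) × stdSimplex ℝ (Fin n))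
    (A : Set X) :
    mass (combination p) A = ∑ i, A.indicator (fun _ => p.2 i) (p.1 i) := by
  unfold mass combination
  simp only
  rw [← Finsupp.sum_finsetSum_index]
  · refine Finset.sum_congr rfl fun i _ => ?_
    rw [Finsupp.sum_single_index (by by_cases hy : p.1 i ∈ A <;> simp [hy])]
  · intro y; by_cases hy : y ∈ A <;> simp [hy]
  · intro y a b; by_cases hy : y ∈ A <;> simp [hy]

theorem toProbabilityMeasure_apply {X : Type u} [MeasurableSpace X] (μ : FinProb X) {A : Set X}
    (hA : MeasurableSet A) :
    (toProbabilityMeasure μ : Measure X) A = ENNReal.ofReal (mass μ A) := by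
  rw [mass_eq_sum, ENNReal.ofReal_sum_of_nonneg
    fun x _ => Set.indicator_nonneg (fun y _ => μ.nonneg y) x]
  simp only [toProbabilityMeasure, ProbabilityMeasure.coe_mk, Measure.coe_finsetSum,
    Finset.sum_apply, Measure.smul_apply, smul_eq_mul, Measure.dirac_apply' _ hA]
  refine Finset.sum_congr rfl fun x _ => ?_
  by_cases hx : x ∈ A <;> simp [hx]

/-- The weak topology on `𝒫(X)`: the coarsest one for which `μ ↦ μ(A)` is lower semicontinuous for
every open set `A`. It makes sense without a metric, which is what allows one to
compare the quotient topology over one space with the Lévy–Prokhorov topology over another. -/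
@[reducible] def weakTopology (X : Type u) [TopologicalSpace X] : TopologicalSpace (FinProb X) :=
  TopologicalSpace.generateFrom {S | ∃ (A : Set X) (c : ℝ), IsOpen A ∧ S = {μ | c < mass μ A}}

theorem continuous_weak_iff {X : Type u} [TopologicalSpace X] {B : Type v} [TopologicalSpace B]
    {s : B → FinProb X} :
    Continuous[_, weakTopology X] s ↔
      ∀ A : Set X, IsOpen A → LowerSemicontinuous fun b => mass (s b) A := by
  simp only [lowerSemicontinuous_iff_isOpen_preimage]
  rw [continuous_generateFrom_iff]
  constructor
  · intro h A hA c
    exact h _ ⟨A, c, hA, rfl⟩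
  · rintro h _ ⟨A, c, hA, rfl⟩
    exact h A hA c

theorem quotientTopology_le_weakTopology (X : Type u) [TopologicalSpace X] :
    quotientTopology X ≤ weakTopology X := by
  refine iSup_le fun n => continuous_iff_coinduced_le.1 ?_
  rw [continuous_weak_iff]
  intro A hA
  suffices h : LowerSemicontinuous fun p : (Fin n → X) × stdSimplex ℝ (Fin n) =>
      mass (combination p) A from h.comp CompactCoherentification.continuous_mk_symm
  simp only [mass_combination]
  refine lowerSemicontinuous_sum fun i _ p c hc => ?_
  by_cases hi : p.1 i ∈ A
  · have h1 : ∀ᶠ q : (Fin n → X) × stdSimplex ℝ (Fin n) in 𝓝 p, q.1 i ∈ A :=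
      (hA.preimage ((continuous_apply i).comp continuous_fst)).mem_nhds hi
    have h2 : ∀ᶠ q : (Fin n → X) × stdSimplex ℝ (Fin n) in 𝓝 p, c < q.2 i := by
      have : Continuous fun q : (Fin n → X) × stdSimplex ℝ (Fin n) => q.2 i :=
        (continuous_apply i).comp (continuous_subtype_val.comp continuous_snd)
      exact this.continuousAt.eventually (lt_mem_nhds (by simpa [hi] using hc))
    filter_upwards [h1, h2] with q hq1 hq2
    simpa [hq1] using hq2
  · have hc0 : c < 0 := by simpa [hi] using hc
    exact Filter.Eventually.of_forall fun q =>
      hc0.trans_le (Set.indicator_nonneg (fun _ _ => q.2.2.1 i) _)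

theorem levyProkhorovTopology_le_weakTopology (X : Type u) [MetricSpace X] :
    levyProkhorovTopology X ≤ weakTopology X := by
  let : MeasurableSpace X := borel X
  have : BorelSpace X := ⟨rfl⟩
  let τ := levyProkhorovTopology X
  rw [← continuous_id_iff_le, continuous_weak_iff]
  intro A hA μ c hc
  simp only [id] at hc ⊢
  -- Only the finitely many points of the support in `A` matter, and they stay in `A` when moved a bit.
  set F : Set X := (μ.weights.support : Set X) ∩ A
  have hFfin : F.Finite := μ.weights.support.finite_toSet.inter_of_left A
  obtain ⟨δ, hδ, hδA⟩ := hFfin.isCompact.exists_thickening_subset_open hA Set.inter_subset_right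
  set ε := min δ (mass μ A - c)
  have hε0 : 0 < ε := lt_min hδ (sub_pos.2 hc)
  have hcont : Continuous fun ν : FinProb X => LevyProkhorov.ofMeasure (toProbabilityMeasure ν) :=
    continuous_induced_dom
  filter_upwards [hcont.continuousAt.eventually (Metric.ball_mem_nhds _ hε0)] with ν hν
  rw [dist_comm, LevyProkhorov.dist_probabilityMeasure_def, levyProkhorovDist,
    ← ENNReal.lt_ofReal_iff_toReal_lt (levyProkhorovEDist_ne_top _ _)] at hν
  obtain ⟨c', h1, h2⟩ := sInf_lt_iff.1 hν
  have h3 := (h1 F hFfin.isClosed.measurableSet).1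
  have hc' : c' ≠ ⊤ := ne_top_of_lt h2
  have h2' : c'.toReal < ε := (ENNReal.lt_ofReal_iff_toReal_lt hc').1 h2
  have h4 : (toProbabilityMeasure μ : Measure X) F ≤
      (toProbabilityMeasure ν : Measure X) A + ENNReal.ofReal c'.toReal := by
    rw [ENNReal.ofReal_toReal hc']
    refine h3.trans (add_le_add (measure_mono ?_) le_rfl)
    exact (Metric.thickening_mono (h2'.le.trans (min_le_left _ _)) F).trans hδA
  rw [toProbabilityMeasure_apply _ hFfin.isClosed.measurableSet,
    toProbabilityMeasure_apply _ hA.measurableSet,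
    ← ENNReal.ofReal_add (mass_nonneg _ _) ENNReal.toReal_nonneg,
    ENNReal.ofReal_le_ofReal_iff (add_nonneg (mass_nonneg _ _) ENNReal.toReal_nonneg)] at h4
  have h5 : mass μ F = mass μ A := mass_congr_of_support fun x hx =>
    ⟨fun h => h.2, fun h => ⟨hx, h⟩⟩
  have h6 : ε ≤ mass μ A - c := min_le_right _ _
  linarith

theorem weakTopology_le_levyProkhorovTopology (X : Type u) [MetricSpace X] :
    weakTopology X ≤ levyProkhorovTopology X := by
  let : MeasurableSpace X := borel X
  have : BorelSpace X := ⟨rfl⟩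
  let τ := weakTopology X
  rw [← continuous_iff_le_induced, continuous_iff_continuousAt]
  intro μ
  refine Metric.tendsto_nhds.2 fun ε hε => ?_
  have hlsc := continuous_weak_iff.1 (continuous_id (X := FinProb X))
  have key : ∀ F ∈ μ.weights.support.powerset, ∀ᶠ ν : FinProb X in 𝓝 μ,
      mass μ F - ε / 2 < mass ν (Metric.thickening (ε / 2) (F : Set X)) := by
    intro F _
    refine hlsc _ Metric.isOpen_thickening μ _ (lt_of_lt_of_le (sub_lt_self _ (half_pos hε)) ?_)
    exact mass_mono_of_support fun x _ hx => Metric.self_subset_thickening (half_pos hε) _ hx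
  filter_upwards [(Finset.eventually_all _).2 key] with ν hν
  rw [dist_comm, LevyProkhorov.dist_probabilityMeasure_def]
  refine lt_of_le_of_lt (levyProkhorovDist_le_of_forall_le _ _ (half_pos hε).le ?_)
    (half_lt_self hε)
  intro r B hr hB
  classical
  have h1 := hν (μ.weights.support.filter (· ∈ B))
    (Finset.mem_powerset.2 (Finset.filter_subset _ _))
  have h2 : mass μ (μ.weights.support.filter (· ∈ B) : Finset X) = mass μ B :=
    mass_congr_of_support fun x hx => by
      simp only [Finset.coe_filter, Set.mem_ofPred_eq, hx, true_and]
  have h3 : mass ν (Metric.thickening (ε / 2) ((μ.weights.support.filter (· ∈ B) : Finset X) : Set X))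
      ≤ mass ν (Metric.thickening r B) := mass_mono_of_support fun x _ hx =>
    Metric.thickening_mono hr.le _ (Metric.thickening_subset_of_subset _ (fun y hy => by
      simp only [Finset.coe_filter, Set.mem_ofPred_eq] at hy; exact hy.2) hx)
  change (toProbabilityMeasure μ : Measure X) B ≤
    (toProbabilityMeasure ν : Measure X) (Metric.thickening r B) + _
  rw [toProbabilityMeasure_apply _ hB,
    toProbabilityMeasure_apply _ Metric.isOpen_thickening.measurableSet,
    ← ENNReal.ofReal_add (mass_nonneg _ _) ((half_pos hε).le.trans hr.le)]
  exact ENNReal.ofReal_le_ofReal (by linarith)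

theorem levyProkhorovTopology_eq_weakTopology (X : Type u) [MetricSpace X] :
    levyProkhorovTopology X = weakTopology X :=
  le_antisymm (levyProkhorovTopology_le_weakTopology X) (weakTopology_le_levyProkhorovTopology X)

/-- Sections of `𝒫_n(f) → Y`, in terms of `𝒫(X)` rather than of its subspace `𝒫_n(f)`. -/
theorem hasSection_iff {X : Type u} {Y : Type v} [TopologicalSpace Y]
    {τ : TopologicalSpace (FinProb X)} {n : ℕ} {f : X → Y} :
    HasSection τ n f ↔ ∃ s : Y → FinProb X, Continuous[_, τ] s ∧
      ∀ y, (s y).weights.support.card ≤ n ∧ ∀ x ∈ (s y).weights.support, f x = y := by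
  constructor
  · rintro ⟨s, hs, hp⟩
    exact ⟨fun y => (s y).1, continuous_induced_rng.1 hs,
      fun y => ⟨(s y).2.1, ((s y).proj_eq_iff y).1 (hp y)⟩⟩
  · rintro ⟨s, hs, hp⟩
    exact ⟨fun y => ⟨s y, (hp y).1, y, (hp y).2⟩, continuous_induced_rng.2 hs,
      fun y => (FiberwiseProb.proj_eq_iff _ y).2 (hp y).2⟩

theorem HasSection.mono {X : Type u} {Y : Type v} [TopologicalSpace Y]
    {τ τ' : TopologicalSpace (FinProb X)} (hτ : τ ≤ τ') {n : ℕ} {f : X → Y}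
    (h : HasSection τ n f) : HasSection τ' n f := by
  rw [hasSection_iff] at h ⊢
  obtain ⟨s, hs, hp⟩ := h
  exact ⟨s, continuous_le_rng hτ hs, hp⟩

theorem card_support_map_le {X : Type u} {Y : Type v} (f : X → Y) (μ : FinProb X) :
    (Convexity.StdSimplex.map f μ).weights.support.card ≤ μ.weights.support.card := by
  classical
  exact (Finset.card_le_card Finsupp.mapDomain_support).trans Finset.card_image_le

theorem exists_of_mem_support_map {X : Type u} {Y : Type v} {f : X → Y} {μ : FinProb X} {y : Y}
    (h : y ∈ (Convexity.StdSimplex.map f μ).weights.support) :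
    ∃ x ∈ μ.weights.support, f x = y := by
  classical
  simpa using Finsupp.mapDomain_support h

theorem map_congr_of_support {X : Type u} {Y : Type v} {f g : X → Y} {μ : FinProb X}
    (h : ∀ x ∈ μ.weights.support, f x = g x) :
    Convexity.StdSimplex.map f μ = Convexity.StdSimplex.map g μ := by
  ext1
  exact Finsupp.mapDomain_congr h

/-- The push-forward of a continuous family of measures along a family of maps is continuous for the
weak topology, if the maps are jointly continuous over the supports. -/
theorem continuous_weak_map {B : Type u} [TopologicalSpace B] {Z : Type v} [TopologicalSpace Z]
    {W : Type w} [TopologicalSpace W] {s : B → FinProb Z} (hs : Continuous[_, weakTopology Z] s)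
    (R : Set (B × Z)) (hR : ∀ b, ∀ z ∈ (s b).weights.support, (b, z) ∈ R)
    {ψ : B × Z → W} (hψ : ContinuousOn ψ R) :
    Continuous[_, weakTopology W] fun b => Convexity.StdSimplex.map (fun z => ψ (b, z)) (s b) := by
  rw [continuous_weak_iff] at hs ⊢
  intro A hA b c hc
  simp only [mass_map] at hc ⊢
  have h1 : ∀ z ∈ (s b).weights.support, ψ (b, z) ∈ A → ∃ U ∈ 𝓝 b, ∃ N : Set Z, IsOpen N ∧ z ∈ N ∧
      ∀ b' ∈ U, ∀ z' ∈ N, (b', z') ∈ R → ψ (b', z') ∈ A := by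
    intro z hz hzA
    have := hψ (b, z) (hR b z hz) (hA.mem_nhds hzA)
    rw [Filter.mem_map, mem_nhdsWithin_iff_exists_mem_nhds_inter] at this
    obtain ⟨T, hT, hTA⟩ := this
    obtain ⟨U, hU, N, hN, hUN⟩ := mem_nhds_prod_iff.1 hT
    obtain ⟨N', hN', hNo, hzN⟩ := mem_nhds_iff.1 hN
    exact ⟨U, hU, N', hNo, hzN, fun b' hb' z' hz' hr => hTA ⟨hUN ⟨hb', hN' hz'⟩, hr⟩⟩
  choose! U hU N hNo hzN hUN using h1
  set S := {z ∈ ((s b).weights.support : Set Z) | ψ (b, z) ∈ A}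
  have hSfin : S.Finite := (s b).weights.support.finite_toSet.subset fun z hz => hz.1
  have h2 : IsOpen (⋃ z ∈ S, N z) := isOpen_biUnion fun z hz => hNo z hz.1 hz.2
  have h3 : c < mass (s b) (⋃ z ∈ S, N z) := hc.trans_le <| mass_mono_of_support fun z hz hzA =>
    Set.mem_biUnion (show z ∈ S from ⟨hz, hzA⟩) (hzN z hz hzA)
  have h4 : ⋂ z ∈ S, U z ∈ 𝓝 b := (Filter.biInter_mem hSfin).2 fun z hz => hU z hz.1 hz.2
  filter_upwards [hs _ h2 b c h3, h4] with b' hb1 hb2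
  refine hb1.trans_le (mass_mono_of_support fun z' hz' hz'N => ?_)
  obtain ⟨z, hz, hzz⟩ := Set.mem_iUnion₂.1 hz'N
  exact hUN z hz.1 hz.2 b' (Set.mem_iInter₂.1 hb2 z hz) z' hzz (hR b' z' hz')

/-! ### Homotopy invariance for the weak topology -/

/-- A path with source `x₀`, as a point of the space of all paths that start at `x₀`. -/
def PathsFrom.ofPath {X : Type u} [TopologicalSpace X] {x₀ x : X} (γ : Path x₀ x) :
    PathsFrom x₀ :=
  ⟨γ.toContinuousMap, γ.source⟩

theorem PathsFrom.endpoint_ofPath {X : Type u} [TopologicalSpace X] {x₀ x : X} (γ : Path x₀ x) :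
    endpoint x₀ (PathsFrom.ofPath γ) = x :=
  γ.target

theorem PathsFrom.continuous_ofPath {X : Type u} [TopologicalSpace X] {x₀ : X} {ι : Type v}
    [TopologicalSpace ι] {b : ι → X} {γ : ∀ i, Path x₀ (b i)} (hγ : Continuous ↿γ) :
    Continuous fun i => PathsFrom.ofPath (γ i) :=
  Continuous.subtype_mk (ContinuousMap.continuous_of_continuous_uncurry _ hγ) _

/-- An element of `PathsFrom x₀` as a path with prescribed end point. -/
def PathsFrom.toPath {X : Type u} [TopologicalSpace X] {x₀ x : X} (γ : PathsFrom x₀)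
    (h : endpoint x₀ γ = x) : Path x₀ x :=
  ⟨γ.1, γ.2, h⟩

/-- If `X` is a homotopy retract of `Y`, then a weakly continuous section over `Y` yields one over
`X`: a path `γ` in `Y` from `y₀` to `f x` yields the path in `X` that runs from `x₀` to `g y₀`, then
along `g ∘ γ`, and then along the homotopy from `g (f x)` to `x`. -/
theorem hasSection_weakTopology_of_homotopy {X : Type u} {Y : Type v} [TopologicalSpace X]
    [TopologicalSpace Y] {n : ℕ} {x₀ : X} {y₀ : Y} (f : C(X, Y)) (g : C(Y, X))
    (H : ContinuousMap.Homotopy (g.comp f) (ContinuousMap.id X)) (hj : Joined x₀ (g y₀))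
    (h : HasSection (weakTopology _) n (endpoint y₀)) :
    HasSection (weakTopology _) n (endpoint x₀) := by
  classical
  rw [hasSection_iff] at h ⊢
  obtain ⟨s, hs, hp⟩ := h
  let R : Set (X × PathsFrom y₀) := {z | endpoint y₀ z.2 = f z.1}
  let Γ : ∀ z : R, Path x₀ z.1.1 := fun z =>
    (hj.somePath.trans ((PathsFrom.toPath z.1.2 z.2).map g.continuous)).trans (H.evalAt z.1.1)
  have hΓ : Continuous ↿Γ := by
    refine Path.trans_continuous_family _ (Path.trans_continuous_family _ ?_ _ ?_) _ ?_
    · exact hj.somePath.continuous.comp continuous_snd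
    · refine g.continuous.comp ?_
      have : Continuous fun z : R × unitInterval => (z.1.1.2.1 : C(unitInterval, Y)) z.2 := by
        fun_prop
      exact this
    · have : Continuous fun z : R × unitInterval => H (z.2, z.1.1.1) := by fun_prop
      exact this
  let ψ : X × PathsFrom y₀ → PathsFrom x₀ := fun z =>
    if hz : z ∈ R then PathsFrom.ofPath (Γ ⟨z, hz⟩) else PathsFrom.ofPath (Path.refl x₀)
  have hψ : ContinuousOn ψ R := by
    rw [continuousOn_iff_continuous_domRestrict]
    convert PathsFrom.continuous_ofPath hΓ using 2 with z
    simp [ψ, z.2]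
  refine ⟨fun x => Convexity.StdSimplex.map (fun γ => ψ (x, γ)) (s (f x)), ?_, fun x => ⟨?_, ?_⟩⟩
  · refine continuous_weak_map (s := fun x => s (f x)) ?_ R (fun x γ hγ => (hp (f x)).2 γ hγ) hψ
    exact @Continuous.comp _ _ _ _ _ (weakTopology _) _ _ hs f.continuous
  · exact (card_support_map_le _ _).trans (hp (f x)).1
  · intro γ' hγ'
    obtain ⟨γ, hγ, rfl⟩ := exists_of_mem_support_map hγ'
    have hz : (x, γ) ∈ R := (hp (f x)).2 γ hγ
    simp only [ψ, hz, dite_true]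
    exact PathsFrom.endpoint_ofPath _

/-! ### Maps out of a geometric realization -/

open Opposite in
/-- The characteristic map `Δᵏ → |S|` of a `k`-simplex of a simplicial set `S`. -/
def characteristicMap (S : SSet.{u}) {k : SimplexCategory} (χ : S.obj (op k)) :
    C(stdSimplex ℝ (Fin (k.len + 1)), SSet.toTop.obj S) :=
  TopCat.toSSetObjEquiv _ (op k) ((sSetTopAdj.unit.app S).app (op k) χ)

open Opposite in
theorem characteristicMap_map (S : SSet.{u}) {m k : SimplexCategory} (θ : m ⟶ k)
    (χ : S.obj (op k)) (t : stdSimplex ℝ (Fin (m.len + 1))) :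
    characteristicMap S (S.map θ.op χ) t = characteristicMap S χ (stdSimplex.map θ t) := by
  have h := NatTrans.naturality_apply (sSetTopAdj.unit.app S) θ.op χ
  unfold characteristicMap
  erw [h]
  rfl

open Opposite in
/-- Compatible continuous maps on the simplices glue to a continuous map on the realization. -/
theorem exists_continuous_realization (S : SSet.{u}) {T : Type u} (τ : TopologicalSpace T)
    (φ : ∀ k : SimplexCategory, S.obj (op k) → stdSimplex ℝ (Fin (k.len + 1)) → T)
    (hφ : ∀ k χ, Continuous (φ k χ))
    (hnat : ∀ (m k : SimplexCategory) (θ : m ⟶ k) (χ : S.obj (op k)) t,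
      φ m (S.map θ.op χ) t = φ k χ (stdSimplex.map θ t)) :
    ∃ F : SSet.toTop.obj S → T, Continuous F ∧
      ∀ (k : SimplexCategory) (χ : S.obj (op k)) t, F (characteristicMap S χ t) = φ k χ t := by
  let f : S ⟶ TopCat.toSSet.obj (TopCat.of T) :=
    { app := fun k => ↾fun χ => (TopCat.toSSetObjEquiv (TopCat.of T) k).symm ⟨φ k.unop χ, hφ _ _⟩
      naturality := by
        intro k m θ
        ext χ
        apply (TopCat.toSSetObjEquiv (TopCat.of T) m).injective
        ext t
        exact hnat m.unop k.unop θ.unop χ t }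
  refine ⟨(sSetTopAdj.homEquiv S (TopCat.of T)).symm f, ContinuousMap.continuous _, ?_⟩
  intro k χ t
  have h : sSetTopAdj.homEquiv S (TopCat.of T) ((sSetTopAdj.homEquiv S (TopCat.of T)).symm f) = f :=
    Equiv.apply_symm_apply _ _
  rw [Adjunction.homEquiv_unit] at h
  have h2 := congrArg (fun z : S ⟶ TopCat.toSSet.obj (TopCat.of T) =>
    TopCat.toSSetObjEquiv (TopCat.of T) (op k) (z.app (op k) χ) t) h
  exact h2

open Opposite in
/-- Maps out of the realization are determined by their restrictions to the simplices. -/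
theorem realization_hom_ext (S : SSet.{u}) {T : TopCat.{u}} {F F' : SSet.toTop.obj S ⟶ T}
    (h : ∀ (k : SimplexCategory) (χ : S.obj (op k)) t,
      F (characteristicMap S χ t) = F' (characteristicMap S χ t)) : F = F' := by
  apply (sSetTopAdj.homEquiv S T).injective
  ext k χ
  apply (TopCat.toSSetObjEquiv T k).injective
  ext t
  rw [Adjunction.homEquiv_unit, Adjunction.homEquiv_unit]
  exact h k.unop χ t

open Opposite in
/-- Every point of the realization lies on a simplex: otherwise the indicator function of the union
of all simplices, as a map to an indiscrete space, would contradict the uniqueness of maps. -/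
theorem exists_characteristicMap_eq (S : SSet.{u}) (b : SSet.toTop.obj S) :
    ∃ (k : SimplexCategory) (χ : S.obj (op k)) (t : stdSimplex ℝ (Fin (k.len + 1))),
      characteristicMap S χ t = b := by
  let T : TopCat.{u} := @TopCat.of (ULift.{u} Prop) ⊤
  let A : SSet.toTop.obj S → Prop := fun b =>
    ∃ (k : SimplexCategory) (χ : S.obj (op k)) (t : stdSimplex ℝ (Fin (k.len + 1))),
      characteristicMap S χ t = b
  let F : SSet.toTop.obj S ⟶ T :=
    @TopCat.ofHom _ _ _ ⊤ (@ContinuousMap.mk _ _ _ ⊤ (fun b => ULift.up (A b)) continuous_top)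
  let F' : SSet.toTop.obj S ⟶ T :=
    @TopCat.ofHom _ _ _ ⊤ (@ContinuousMap.mk _ _ _ ⊤ (fun _ => ULift.up True) continuous_top)
  have h : F = F' := realization_hom_ext S fun k χ t =>
    congrArg ULift.up (eq_true (⟨k, χ, t, rfl⟩ : A _))
  have h2 : ULift.up (A b) = ULift.up True := congrArg (fun z : SSet.toTop.obj S ⟶ T => z b) h
  exact of_eq_true (ULift.up_injective h2)

/-! ### A free action of a group on a space of functions -/

/-- The space of functions `[0, 1) → G`, whose topology is that of convergence in measure. It serves
as a convenient total space of a covering: it receives a `G`-equivariant map from the total space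
`EG`, and the action of `G` on it moves every point by distance `1`. -/
def IcoFun (G : Type u) : Type u := Set.Ico (0 : ℝ) 1 → G

namespace IcoFun

variable {G : Type u}

/-- The subset of `[0, 1)` where two functions disagree. -/
def disagreement (f h : IcoFun G) : Set ℝ := Subtype.val '' {x : Set.Ico (0 : ℝ) 1 | f x ≠ h x}

theorem volume_disagreement_le (f h : IcoFun G) : volume (disagreement f h) ≤ 1 := by
  refine (measure_mono (t := Set.Ico (0 : ℝ) 1) ?_).trans (by simp)
  rintro _ ⟨x, -, rfl⟩
  exact x.2

theorem volume_disagreement_ne_top (f h : IcoFun G) : volume (disagreement f h) ≠ ⊤ :=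
  ne_top_of_le_ne_top ENNReal.one_ne_top (volume_disagreement_le f h)

/-- The distance is the (outer) measure of the set where the functions disagree; no measurability is
needed for the triangle inequality. -/
instance : PseudoMetricSpace (IcoFun G) where
  dist f h := (volume (disagreement f h)).toReal
  dist_self f := by simp [disagreement]
  dist_comm f h := by simp only [disagreement, ne_comm]
  dist_triangle f h l := by
    rw [← ENNReal.toReal_add (volume_disagreement_ne_top _ _) (volume_disagreement_ne_top _ _)]
    refine ENNReal.toReal_mono (by simp [volume_disagreement_ne_top]) ?_
    refine (measure_mono ?_).trans (measure_union_le _ _)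
    rintro _ ⟨x, hx, rfl⟩
    by_cases hfh : f x = h x
    · exact Or.inr ⟨x, fun hhl => hx (hfh.trans hhl), rfl⟩
    · exact Or.inl ⟨x, hfh, rfl⟩

theorem dist_def (f h : IcoFun G) : dist f h = (volume (disagreement f h)).toReal := rfl

variable [Group G]

instance : MulAction G (IcoFun G) := inferInstanceAs (MulAction G (Set.Ico (0 : ℝ) 1 → G))

theorem smul_apply (g : G) (f : IcoFun G) (x : Set.Ico (0 : ℝ) 1) : (g • f) x = g * f x := rfl

theorem dist_smul_smul (g : G) (f h : IcoFun G) : dist (g • f) (g • h) = dist f h := by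
  simp [dist_def, disagreement, smul_apply]

theorem dist_smul_self {g : G} (hg : g ≠ 1) (f : IcoFun G) : dist (g • f) f = 1 := by
  have h : disagreement (g • f) f = Set.Ico 0 1 := by
    simp [disagreement, smul_apply, hg, Set.Ico_def]
  simp [dist_def, h]

theorem eq_one_of_dist_smul_self_lt {g : G} {f : IcoFun G} (h : dist (g • f) f < 1) : g = 1 := by
  by_contra hg
  exact absurd (dist_smul_self hg f) h.ne

variable (G) in
/-- The quotient of the space of functions `[0, 1) → G` by `G`, a metric model of the classifying
space. -/
abbrev Orbits : Type u := MulAction.orbitRel.Quotient G (IcoFun G)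

variable (G) in
/-- The quotient map by the action of `G`. -/
abbrev toOrbits : IcoFun G → Orbits G := Quotient.mk _

theorem isQuotientCoveringMap_toOrbits : IsQuotientCoveringMap (toOrbits G) G where
  __ := isQuotientMap_quotient_mk'
  continuous_const_smul g := (Isometry.of_dist_eq (dist_smul_smul g)).continuous
  apply_eq_iff_mem_orbit := Quotient.eq''
  disjoint f := by
    refine ⟨Metric.ball f (1 / 2), Metric.ball_mem_nhds _ (by norm_num), fun g => ?_⟩
    rintro ⟨_, ⟨h, hh, rfl⟩, hgh⟩
    refine eq_one_of_dist_smul_self_lt (f := h) ?_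
    rw [Metric.mem_ball] at hh hgh
    have := dist_triangle_right (g • h) h f
    simp only at hgh
    linarith

theorem toOrbits_smul (g : G) (f : IcoFun G) : toOrbits G (g • f) = toOrbits G f :=
  isQuotientCoveringMap_toOrbits.map_smul g

theorem exists_smul_eq_of_toOrbits_eq {f h : IcoFun G} (e : toOrbits G f = toOrbits G h) :
    ∃ g : G, g • h = f :=
  isQuotientCoveringMap_toOrbits.apply_eq_iff_mem_orbit.1 e

end IcoFun

/-! ### Step functions -/

/-- The partial sum `t 0 + … + t i` of barycentric coordinates. -/
def partialSum {k : ℕ} (t : stdSimplex ℝ (Fin (k + 1))) (i : Fin (k + 1)) : ℝ :=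
  ∑ j ∈ Finset.Iic i, t j

theorem exists_pieceIndex {k : ℕ} (t : stdSimplex ℝ (Fin (k + 1))) (x : Set.Ico (0 : ℝ) 1) :
    ∃ i, (x : ℝ) < partialSum t i ∧ ∀ j < i, partialSum t j ≤ x := by
  have h : ((Finset.univ.filter fun i => (x : ℝ) < partialSum t i)).Nonempty := by
    refine ⟨Fin.last k, ?_⟩
    have : Finset.Iic (Fin.last k) = Finset.univ := by
      ext i; simp [Fin.le_last]
    refine Finset.mem_filter.2 ⟨Finset.mem_univ _, ?_⟩
    rw [partialSum, this, stdSimplex.sum_eq_one]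
    exact x.2.2
  refine ⟨_, (Finset.mem_filter.1 (Finset.min'_mem _ h)).2, fun j hj => ?_⟩
  by_contra hlt
  exact absurd (Finset.min'_le _ j (by simpa using hlt)) (not_le.2 hj)

/-- Barycentric coordinates `t` cut `[0, 1)` into consecutive intervals of lengths `t i`; this is the
index of the interval that contains `x`. -/
def pieceIndex {k : ℕ} (t : stdSimplex ℝ (Fin (k + 1))) (x : Set.Ico (0 : ℝ) 1) : Fin (k + 1) :=
  (exists_pieceIndex t x).choose

theorem lt_partialSum_pieceIndex {k : ℕ} (t : stdSimplex ℝ (Fin (k + 1))) (x : Set.Ico (0 : ℝ) 1) :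
    (x : ℝ) < partialSum t (pieceIndex t x) :=
  (exists_pieceIndex t x).choose_spec.1

theorem partialSum_le_of_lt_pieceIndex {k : ℕ} {t : stdSimplex ℝ (Fin (k + 1))}
    {x : Set.Ico (0 : ℝ) 1} {j : Fin (k + 1)} (h : j < pieceIndex t x) : partialSum t j ≤ x :=
  (exists_pieceIndex t x).choose_spec.2 j h

theorem pieceIndex_eq_iff {k : ℕ} {t : stdSimplex ℝ (Fin (k + 1))} {x : Set.Ico (0 : ℝ) 1}
    {i : Fin (k + 1)} :
    pieceIndex t x = i ↔ (x : ℝ) < partialSum t i ∧ ∀ j < i, partialSum t j ≤ x := by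
  constructor
  · rintro rfl
    exact ⟨lt_partialSum_pieceIndex t x, fun j => partialSum_le_of_lt_pieceIndex⟩
  · rintro ⟨h1, h2⟩
    refine le_antisymm (le_of_not_gt fun h => ?_) (le_of_not_gt fun h => ?_)
    · exact absurd (partialSum_le_of_lt_pieceIndex h) (not_le.2 h1)
    · exact absurd (h2 _ h) (not_le.2 (lt_partialSum_pieceIndex t x))

theorem partialSum_map {m k : ℕ} (θ : Fin (m + 1) →o Fin (k + 1)) (t : stdSimplex ℝ (Fin (m + 1)))
    (j : Fin (k + 1)) :
    partialSum (stdSimplex.map θ t) j = ∑ i with θ i ≤ j, t i := by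
  unfold partialSum
  rw [← Finset.sum_fiberwise_of_maps_to (s := {i | θ i ≤ j}) (t := Finset.Iic j) (g := θ)
    (fun i hi => by simpa using hi)]
  refine Finset.sum_congr rfl fun i hi => ?_
  rw [stdSimplex.map_coe, FunOnFinite.linearMap_apply_apply]
  refine Finset.sum_congr ?_ fun _ _ => rfl
  ext l
  simp only [Finset.mem_filter, Finset.mem_univ, true_and]
  exact ⟨fun h => ⟨h ▸ Finset.mem_Iic.1 hi, h⟩, fun h => h.2⟩

theorem pieceIndex_map {m k : ℕ} (θ : Fin (m + 1) →o Fin (k + 1))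
    (t : stdSimplex ℝ (Fin (m + 1))) (x : Set.Ico (0 : ℝ) 1) :
    pieceIndex (stdSimplex.map θ t) x = θ (pieceIndex t x) := by
  rw [pieceIndex_eq_iff]
  constructor
  · rw [partialSum_map]
    refine (lt_partialSum_pieceIndex t x).trans_le ?_
    refine Finset.sum_le_sum_of_subset_of_nonneg (fun i hi => ?_) fun i _ _ => t.2.1 i
    simpa using θ.monotone (Finset.mem_Iic.1 hi)
  · intro j hj
    rw [partialSum_map]
    by_cases hne : ({i | θ i ≤ j} : Finset (Fin (m + 1))).Nonempty
    · -- All indices that are mapped below `j` come before the piece of `x`.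
      set i₀ := Finset.max' _ hne
      have h0 : θ i₀ ≤ j := by
        have := Finset.max'_mem _ hne
        simpa using this
      have h1 : i₀ < pieceIndex t x := by
        by_contra hlt
        exact absurd (θ.monotone (not_lt.1 hlt)) (not_le.2 (h0.trans_lt hj))
      refine le_trans ?_ (partialSum_le_of_lt_pieceIndex h1)
      refine Finset.sum_le_sum_of_subset_of_nonneg (fun i hi => ?_) fun i _ _ => t.2.1 i
      exact Finset.mem_Iic.2 (Finset.le_max' _ _ hi)
    · rw [Finset.not_nonempty_iff_eq_empty.1 hne, Finset.sum_empty]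
      exact x.2.1

/-- The function on `[0, 1)` that takes the value `v i` on the `i`-th of consecutive intervals of
lengths `t 0, …, t k`. -/
def stepFun {G : Type u} {k : ℕ} (v : Fin (k + 1) → G) (t : stdSimplex ℝ (Fin (k + 1))) :
    IcoFun G :=
  fun x => v (pieceIndex t x)

theorem stepFun_map {G : Type u} {m k : ℕ} (θ : Fin (m + 1) →o Fin (k + 1))
    (v : Fin (k + 1) → G) (t : stdSimplex ℝ (Fin (m + 1))) :
    stepFun v (stdSimplex.map θ t) = stepFun (v ∘ θ) t :=
  funext fun x => congrArg v (pieceIndex_map θ t x)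

theorem stepFun_smul {G : Type u} [Group G] {k : ℕ} (g : G) (v : Fin (k + 1) → G)
    (t : stdSimplex ℝ (Fin (k + 1))) : stepFun (g • v) t = g • stepFun v t := rfl

theorem disagreement_stepFun_subset {G : Type u} {k : ℕ} (v : Fin (k + 1) → G)
    (t t' : stdSimplex ℝ (Fin (k + 1))) :
    IcoFun.disagreement (stepFun v t) (stepFun v t') ⊆
      ⋃ i, Set.uIcc (partialSum t i) (partialSum t' i) := by
  rintro _ ⟨x, hx, rfl⟩
  by_contra hnot
  simp only [Set.mem_iUnion, not_exists, Set.mem_uIcc, not_or, not_and, not_le] at hnot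
  refine hx (congrArg v (pieceIndex_eq_iff.2 ⟨?_, fun j hj => ?_⟩))
  · by_contra h
    exact lt_asymm ((hnot _).1 (not_lt.1 h)) (lt_partialSum_pieceIndex t' x)
  · exact ((hnot j).2 (partialSum_le_of_lt_pieceIndex hj)).le

theorem continuous_stepFun {G : Type u} {k : ℕ} (v : Fin (k + 1) → G) :
    Continuous (stepFun v) := by
  rw [continuous_iff_continuousAt]
  intro t
  rw [ContinuousAt, tendsto_iff_dist_tendsto_zero]
  have hb : ∀ t', dist (stepFun v t') (stepFun v t) ≤ ∑ i, |partialSum t i - partialSum t' i| := by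
    intro t'
    rw [IcoFun.dist_def]
    refine ENNReal.toReal_le_of_le_ofReal (Finset.sum_nonneg fun _ _ => abs_nonneg _) ?_
    rw [ENNReal.ofReal_sum_of_nonneg fun _ _ => abs_nonneg _]
    refine (measure_mono (disagreement_stepFun_subset v t' t)).trans ?_
    refine (measure_iUnion_fintype_le _ _).trans (Finset.sum_le_sum fun i _ => ?_)
    rw [Real.volume_interval]
  refine squeeze_zero (fun _ => dist_nonneg) hb ?_
  have hc : Continuous fun t' => ∑ i, |partialSum t i - partialSum t' i| := by
    unfold partialSum
    refine continuous_finsetSum _ fun i _ => (continuous_const.sub ?_).abs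
    exact continuous_finsetSum _ fun j _ => (continuous_apply j).comp continuous_subtype_val
  simpa using hc.tendsto t

/-! ### Simplices of the classifying space -/

section Nerve

variable {G : Type u} [Group G]

open Opposite

/-- The simplex of the nerve of `G` with edges `(v j)⁻¹ * v i`. It is the image of the simplex with
vertices `v 0, …, v k` of `EG`; translating the labels `v` from the left does not change it. -/
def ofLabels {k : SimplexCategory} (v : Fin (k.len + 1) → G) :
    (nerve (SingleObj G)).obj (op k) :=
  { obj := fun _ => SingleObj.star G
    map := fun {i j} _ => ((v j)⁻¹ * v i : G)
    map_id := fun i => inv_mul_cancel (v i)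
    map_comp := fun {i j l} _ _ => by
      simp only [SingleObj.comp_as_mul]
      group }

/-- Labels of the vertices of a simplex of the nerve of `G`, normalized by the condition that
the initial vertex has the label `1`. -/
def labels {k : SimplexCategory} (χ : (nerve (SingleObj G)).obj (op k)) (i : Fin (k.len + 1)) : G :=
  (show G from (show Fin (k.len + 1) ⥤ SingleObj G from χ).map (homOfLE (Fin.zero_le i)))⁻¹

theorem map_ofLabels {m k : SimplexCategory} (θ : m ⟶ k) (v : Fin (k.len + 1) → G) :
    (nerve (SingleObj G)).map θ.op (ofLabels v) = ofLabels (v ∘ θ) := rfl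

theorem ofLabels_smul {k : SimplexCategory} (g : G) (v : Fin (k.len + 1) → G) :
    ofLabels (g • v) = ofLabels v := by
  refine CategoryTheory.Functor.ext (fun _ => rfl) fun i j _ => ?_
  simp only [ofLabels, Pi.smul_apply, smul_eq_mul, eqToHom_refl, Category.comp_id, Category.id_comp]
  group

theorem ofLabels_labels {k : SimplexCategory} (χ : (nerve (SingleObj G)).obj (op k)) :
    ofLabels (labels χ) = χ := by
  refine CategoryTheory.Functor.ext (fun _ => rfl) fun i j f => ?_
  have h : (χ.map (homOfLE (Fin.zero_le j)) : G) =
      (χ.map f : G) * (χ.map (homOfLE (Fin.zero_le i)) : G) :=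
    Functor.map_comp (show Fin (k.len + 1) ⥤ SingleObj G from χ) (homOfLE (Fin.zero_le i)) f
  simp only [eqToHom_refl, Category.comp_id, Category.id_comp]
  change (χ.map (homOfLE (Fin.zero_le j)) : G)⁻¹⁻¹ * (χ.map (homOfLE (Fin.zero_le i)) : G)⁻¹ = χ.map f
  rw [h]
  group

theorem exists_labels_map_eq_smul {m k : SimplexCategory} (θ : m ⟶ k)
    (χ : (nerve (SingleObj G)).obj (op k)) :
    ∃ g : G, labels ((nerve (SingleObj G)).map θ.op χ) = g • (labels χ ∘ θ) := by
  refine ⟨(labels χ (θ 0))⁻¹, ?_⟩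
  conv_lhs => rw [← ofLabels_labels χ, map_ofLabels]
  ext i
  change ((labels χ (θ i))⁻¹ * labels χ (θ 0))⁻¹ = (labels χ (θ 0))⁻¹ * labels χ (θ i)
  group

variable (G) in
/-- The vertex of the classifying space. -/
def classifyingSpaceVertex : ClassifyingSpace G :=
  characteristicMap (nerve (SingleObj G)) (k := SimplexCategory.mk 0) (ofLabels fun _ => 1)
    (stdSimplex.vertex 0)

/-- The point `(1 - u) • e₀ + u • t` of the join of a new vertex `e₀` with a simplex. -/
def conePoint {k : ℕ} (u : unitInterval) (t : stdSimplex ℝ (Fin (k + 1))) :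
    stdSimplex ℝ (Fin (k + 2)) :=
  ⟨Fin.cons (1 - (u : ℝ)) fun i => u * t i, by
    constructor
    · refine Fin.cases ?_ fun i => ?_
      · exact sub_nonneg.2 u.2.2
      · exact mul_nonneg u.2.1 (t.2.1 i)
    · have := stdSimplex.sum_eq_one t
      simp [Fin.sum_univ_succ (n := k + 1), ← Finset.mul_sum, this]⟩

theorem coe_conePoint {k : ℕ} (u : unitInterval) (t : stdSimplex ℝ (Fin (k + 1))) :
    ⇑(conePoint u t) = Fin.cons (1 - (u : ℝ)) fun i => (u : ℝ) * t i := rfl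

theorem continuous_conePoint {k : ℕ} :
    Continuous fun z : stdSimplex ℝ (Fin (k + 1)) × unitInterval => conePoint z.2 z.1 := by
  refine Continuous.subtype_mk (continuous_pi fun i => ?_) _
  have h (j : Fin (k + 1)) : Continuous fun t : stdSimplex ℝ (Fin (k + 1)) => t j :=
    (continuous_apply j).comp continuous_subtype_val
  refine Fin.cases ?_ (fun j => ?_) i
  · simp only [Fin.cons_zero]; fun_prop
  · simp only [Fin.cons_succ]
    exact (continuous_subtype_val.comp continuous_snd).mul ((h j).comp continuous_fst)

theorem stdSimplex_map_apply {ι κ : Type*} [Fintype ι] [Fintype κ] [DecidableEq κ] (f : ι → κ)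
    (t : stdSimplex ℝ ι) (j : κ) : stdSimplex.map f t j = ∑ i, if f i = j then t i else 0 := by
  rw [stdSimplex.map_coe, FunOnFinite.linearMap_apply_apply, Finset.sum_filter]

theorem conePoint_one {k : ℕ} (t : stdSimplex ℝ (Fin (k + 1))) :
    conePoint 1 t = stdSimplex.map Fin.succ t := by
  ext j
  rw [stdSimplex_map_apply, coe_conePoint]
  refine Fin.cases ?_ (fun j => ?_) j
  · simp
  · simp

theorem conePoint_zero {k : ℕ} (t : stdSimplex ℝ (Fin (k + 1))) (s : stdSimplex ℝ (Fin 1)) :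
    conePoint 0 t = stdSimplex.map (fun _ => 0) s := by
  ext j
  rw [stdSimplex_map_apply, coe_conePoint]
  refine Fin.cases ?_ (fun j => ?_) j
  · simp
  · simp [(Fin.succ_ne_zero j).symm]

/-- The map `0 ↦ 0`, `i + 1 ↦ θ i + 1`. -/
def coneHom {m k : ℕ} (θ : Fin (m + 1) →o Fin (k + 1)) : Fin (m + 2) →o Fin (k + 2) where
  toFun := Fin.cons 0 fun i => (θ i).succ
  monotone' := by
    intro i j
    refine Fin.cases ?_ (fun i => ?_) i
    · simp
    · refine Fin.cases ?_ (fun j => ?_) j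
      · simp
      · simpa using fun h => θ.monotone h

theorem coneHom_zero {m k : ℕ} (θ : Fin (m + 1) →o Fin (k + 1)) : coneHom θ 0 = 0 := rfl

theorem coneHom_succ {m k : ℕ} (θ : Fin (m + 1) →o Fin (k + 1)) (i : Fin (m + 1)) :
    coneHom θ i.succ = (θ i).succ := rfl

theorem conePoint_map {m k : ℕ} (θ : Fin (m + 1) →o Fin (k + 1)) (u : unitInterval)
    (t : stdSimplex ℝ (Fin (m + 1))) :
    conePoint u (stdSimplex.map θ t) = stdSimplex.map (coneHom θ) (conePoint u t) := by
  ext j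
  rw [stdSimplex_map_apply, coe_conePoint, coe_conePoint, Fin.sum_univ_succ (n := m + 1)]
  refine Fin.cases ?_ (fun j => ?_) j
  · simp [coneHom_zero, coneHom_succ]
  · simp [coneHom_zero, coneHom_succ, (Fin.succ_ne_zero j).symm, stdSimplex_map_apply,
      Finset.mul_sum]

theorem cons_one_comp_coneHom {m k : ℕ} (θ : Fin (m + 1) →o Fin (k + 1)) (v : Fin (k + 1) → G) :
    (Fin.cons 1 v : Fin (k + 2) → G) ∘ coneHom θ = Fin.cons 1 (v ∘ θ) := by
  ext j
  refine Fin.cases ?_ (fun j => ?_) j <;> simp [coneHom_zero, coneHom_succ]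

/-- The image in `BG` of the point with coordinates `t` of the simplex of `EG` with vertices `v`. -/
def labeledPoint {k : ℕ} (v : Fin (k + 1) → G) (t : stdSimplex ℝ (Fin (k + 1))) :
    ClassifyingSpace G :=
  characteristicMap (nerve (SingleObj G)) (k := SimplexCategory.mk k) (ofLabels v) t

theorem continuous_labeledPoint {k : ℕ} (v : Fin (k + 1) → G) : Continuous (labeledPoint v) :=
  ContinuousMap.continuous _

theorem labeledPoint_map {m k : ℕ} (θ : Fin (m + 1) →o Fin (k + 1)) (v : Fin (k + 1) → G)
    (t : stdSimplex ℝ (Fin (m + 1))) :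
    labeledPoint v (stdSimplex.map θ t) = labeledPoint (v ∘ θ) t :=
  (characteristicMap_map (nerve (SingleObj G)) (SimplexCategory.mkHom θ) (ofLabels v) t).symm

/-- The canonical contraction of `EG` moves each point in a straight line, in the join of its simplex
with the vertex `1`. This is the image in `BG` of the track of a point, run backwards. -/
def conePath {k : ℕ} (v : Fin (k + 1) → G) (t : stdSimplex ℝ (Fin (k + 1))) :
    Path (classifyingSpaceVertex G) (labeledPoint v t) where
  toFun u := labeledPoint (Fin.cons 1 v : Fin (k + 2) → G) (conePoint u t)
  continuous_toFun := (continuous_labeledPoint _).comp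
    (continuous_conePoint.comp (Continuous.prodMk_right t))
  source' := by
    rw [conePoint_zero t (stdSimplex.vertex 0)]
    exact labeledPoint_map (m := 0) (OrderHom.const _ 0) _ _
  target' := by
    rw [conePoint_one]
    exact labeledPoint_map (Fin.succOrderEmb (k + 1)).toOrderHom _ _

theorem continuous_conePath {k : ℕ} (v : Fin (k + 1) → G) : Continuous ↿(conePath v) :=
  (continuous_labeledPoint _).comp continuous_conePoint

theorem conePath_map {m k : ℕ} (θ : Fin (m + 1) →o Fin (k + 1)) (v : Fin (k + 1) → G)
    (t : stdSimplex ℝ (Fin (m + 1))) (u : unitInterval) :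
    conePath v (stdSimplex.map θ t) u = conePath (v ∘ θ) t u := by
  change labeledPoint _ _ = labeledPoint _ _
  rw [conePoint_map, labeledPoint_map, cons_one_comp_coneHom]

theorem characteristicMap_eq_labeledPoint (k : SimplexCategory)
    (χ : (nerve (SingleObj G)).obj (op k)) (t : stdSimplex ℝ (Fin (k.len + 1))) (g : G) :
    characteristicMap (nerve (SingleObj G)) χ t = labeledPoint (g • labels χ) t := by
  conv_lhs => rw [← ofLabels_labels χ, ← ofLabels_smul g]
  rfl

theorem joined_classifyingSpaceVertex (b : ClassifyingSpace G) :
    Joined (classifyingSpaceVertex G) b := by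
  obtain ⟨k, χ, t, rfl⟩ := exists_characteristicMap_eq _ b
  rw [characteristicMap_eq_labeledPoint k χ t 1]
  exact ⟨conePath _ t⟩

/-- The map from the classifying space to the quotient of the space of functions `[0, 1) → G` that
sends a point with coordinates `t` to the class of a step function with steps of lengths `t`. -/
theorem exists_classifyingMap (G : Type u) [Group G] :
    ∃ Φ : ClassifyingSpace G → IcoFun.Orbits G, Continuous Φ ∧
      ∀ (k : SimplexCategory) (χ : (nerve (SingleObj G)).obj (op k)) t,
        Φ (characteristicMap _ χ t) = IcoFun.toOrbits G (stepFun (labels χ) t) := by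
  refine exists_continuous_realization _ inferInstance
    (fun k χ t => IcoFun.toOrbits G (stepFun (labels χ) t)) ?_ ?_
  · intro k χ
    exact IcoFun.isQuotientCoveringMap_toOrbits.continuous.comp (continuous_stepFun _)
  · intro m k θ χ t
    obtain ⟨g, hg⟩ := exists_labels_map_eq_smul θ χ
    rw [hg, stepFun_smul, IcoFun.toOrbits_smul]
    exact congrArg _ (stepFun_map θ.toOrderHom (labels χ) t).symm

end Nerve

/-- Path lifting along a covering map, with continuous dependence of the end point on the path. -/
theorem exists_continuous_lift_endpoint {E : Type u} {B : Type v} {Y : Type w} [TopologicalSpace E]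
    [TopologicalSpace B] [TopologicalSpace Y] {p : E → B} (hp : IsCoveringMap p) {Φ : Y → B}
    (hΦ : Continuous Φ) (y₀ : Y) {e₀ : E} (he₀ : p e₀ = Φ y₀) :
    ∃ L : PathsFrom y₀ → E, Continuous L ∧ ∀ γ, p (L γ) = Φ (endpoint y₀ γ) := by
  let H : C(unitInterval × PathsFrom y₀, B) := ⟨fun z => Φ (z.2.1 z.1), hΦ.comp (by fun_prop)⟩
  have H0 : ∀ γ, H (0, γ) = p (ContinuousMap.const (PathsFrom y₀) e₀ γ) := fun γ => by
    change Φ (γ.1 0) = p e₀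
    rw [γ.2, he₀]
  refine ⟨fun γ => hp.liftHomotopy H _ H0 (1, γ), by fun_prop, fun γ => ?_⟩
  exact congrFun (hp.liftHomotopy_lifts H _ H0) (1, γ)

/-! ### Push-forward along a map that factors through a finite set -/

theorem sum_mass_fibers {X : Type u} {n : ℕ} (h : X → Fin n) (μ : FinProb X) :
    ∑ i, mass μ (h ⁻¹' {i}) = 1 := by
  simp only [mass_eq_sum]
  rw [Finset.sum_comm]
  refine Eq.trans (Finset.sum_congr rfl fun x _ => ?_) μ.total
  rw [Finset.sum_eq_single (h x) (fun i _ hi => Set.indicator_of_notMem (fun h' => hi h'.symm) _)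
    (by simp)]
  simp

/-- The masses of the fibers of a map to a finite set, as barycentric coordinates. -/
def fiberMasses {X : Type u} {n : ℕ} (h : X → Fin n) (μ : FinProb X) : stdSimplex ℝ (Fin n) :=
  ⟨fun i => mass μ (h ⁻¹' {i}), fun _ => mass_nonneg _ _, sum_mass_fibers h μ⟩

theorem map_eq_combination {X : Type u} {W : Type v} {n : ℕ} (h : X → Fin n) (r : Fin n → W)
    (μ : FinProb X) :
    Convexity.StdSimplex.map (fun x => r (h x)) μ = combination (r, fiberMasses h μ) := by
  have hw : ∀ i, (Convexity.StdSimplex.map h μ).weights i = mass μ (h ⁻¹' {i}) := by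
    intro i
    rw [← mass_map, mass, Finsupp.sum_fintype _ _ fun j => by by_cases hj : j = i <;> simp [hj]]
    simp [Set.indicator_apply]
  rw [← Convexity.StdSimplex.map_map μ h r]
  ext1
  rw [Convexity.StdSimplex.weights_map, Finsupp.mapDomain,
    Finsupp.sum_fintype _ _ fun j => Finsupp.single_zero _]
  simp only [hw]
  rfl

/-- Lower semicontinuous functions with constant sum are continuous. -/
theorem continuous_of_lowerSemicontinuous_of_sum_eq {B : Type u} [TopologicalSpace B] {n : ℕ}
    {f : Fin n → B → ℝ} {c : ℝ} (hf : ∀ i, LowerSemicontinuous (f i)) (hc : ∀ b, ∑ i, f i b = c)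
    (i : Fin n) : Continuous (f i) := by
  refine continuous_iff_lower_upperSemicontinuous.2 ⟨hf i, fun b a ha => ?_⟩
  have hs : ∀ b, f i b = c - ∑ j ∈ Finset.univ.erase i, f j b := fun b => by
    rw [← hc b, ← Finset.add_sum_erase _ _ (Finset.mem_univ i)]; ring
  have hl : LowerSemicontinuous fun b => ∑ j ∈ Finset.univ.erase i, f j b :=
    lowerSemicontinuous_sum fun j _ => hf j
  have hb : c - a < ∑ j ∈ Finset.univ.erase i, f j b := by
    have := hs b
    simp only at ha
    linarith
  filter_upwards [hl b _ hb] with b' hb'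
  have := hs b'
  linarith

/-- A family of points and barycentric coordinates over a compact space gives a family of measures
that is continuous for the quotient topology: a continuous map from a compact space to a product stays
continuous when the product gets the compactly generated topology. -/
theorem continuous_combination {X : Type u} [TopologicalSpace X] {B : Type v} [TopologicalSpace B]
    [CompactSpace B] {n : ℕ} {p : B → (Fin n → X) × stdSimplex ℝ (Fin n)} (hp : Continuous p) :
    Continuous[_, quotientTopology X] fun b => combination (p b) := by
  let q : B → CompactCoherentification ((Fin n → X) × stdSimplex ℝ (Fin n)) :=
    fun b => CompactCoherentification.mk _ (p b)
  have hq : Continuous q := CompactCoherentification.continuous_rng_of_compactSpace.2 hp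
  have hc : Continuous[_, quotientTopology X]
      (fun p : CompactCoherentification ((Fin n → X) × stdSimplex ℝ (Fin n)) =>
        combination ((CompactCoherentification.mk _).symm p)) :=
    continuous_iff_coinduced_le.2 (le_iSup (fun n : ℕ => TopologicalSpace.coinduced
      (fun p : CompactCoherentification ((Fin n → X) × stdSimplex ℝ (Fin n)) =>
        combination ((CompactCoherentification.mk _).symm p)) inferInstance) n)
  exact @Continuous.comp _ _ _ _ _ (quotientTopology X) _ _ hc hq

/-! ### From the weak topology to the quotient topology -/

section Rays

variable {G : Type u} [Group G]

open Opposite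

/-- A path from the base point to the vertex of `BG`, followed by the image in `BG` of the straight
line to a point of `EG`. -/
def ray {b₀ : ClassifyingSpace G} (α : Path b₀ (classifyingSpaceVertex G)) {k : ℕ}
    (v : Fin (k + 1) → G) (t : stdSimplex ℝ (Fin (k + 1))) : PathsFrom b₀ :=
  PathsFrom.ofPath (α.trans (conePath v t))

theorem continuous_ray {b₀ : ClassifyingSpace G} (α : Path b₀ (classifyingSpaceVertex G)) {k : ℕ}
    (v : Fin (k + 1) → G) : Continuous (ray α v) :=
  PathsFrom.continuous_ofPath <| Path.trans_continuous_family (fun _ => α)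
    (α.continuous.comp continuous_snd) (conePath v) (continuous_conePath v)

theorem ray_map {b₀ : ClassifyingSpace G} (α : Path b₀ (classifyingSpaceVertex G)) {m k : ℕ}
    (θ : Fin (m + 1) →o Fin (k + 1)) (v : Fin (k + 1) → G) (t : stdSimplex ℝ (Fin (m + 1))) :
    ray α v (stdSimplex.map θ t) = ray α (v ∘ θ) t := by
  refine Subtype.ext (ContinuousMap.ext fun u => ?_)
  change α.trans (conePath v (stdSimplex.map θ t)) u = α.trans (conePath (v ∘ θ) t) u
  rw [Path.trans_apply, Path.trans_apply]
  split_ifs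
  · rfl
  · exact conePath_map θ v t _

/-- The element of `G` that carries a step function to `f`, if there is such an element. -/
def sheet (f : IcoFun G) {k : ℕ} (v : Fin (k + 1) → G) (t : stdSimplex ℝ (Fin (k + 1))) : G :=
  f ⟨0, le_rfl, one_pos⟩ * (stepFun v t ⟨0, le_rfl, one_pos⟩)⁻¹

theorem sheet_smul_stepFun (g : G) {k : ℕ} (v : Fin (k + 1) → G)
    (t : stdSimplex ℝ (Fin (k + 1))) : sheet (g • stepFun v t) v t = g := by
  simp [sheet, IcoFun.smul_apply]

theorem stepFun_sheet_smul {f : IcoFun G} {k : ℕ} {v : Fin (k + 1) → G}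
    {t : stdSimplex ℝ (Fin (k + 1))} (h : IcoFun.toOrbits G f = IcoFun.toOrbits G (stepFun v t)) :
    stepFun (sheet f v t • v) t = f := by
  obtain ⟨g, rfl⟩ := IcoFun.exists_smul_eq_of_toOrbits_eq h
  rw [sheet_smul_stepFun, stepFun_smul]

/-- The labels of a simplex of `BG` are determined by the values of a step function. -/
theorem smul_eq_of_stepFun_eq {k : ℕ} {g g' : G} {v : Fin (k + 1) → G}
    {t : stdSimplex ℝ (Fin (k + 1))} (h : stepFun (g • v) t = stepFun (g' • v) t) :
    g • v = g' • v := by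
  rw [stepFun_smul, stepFun_smul] at h
  rw [← sheet_smul_stepFun g v t, h, sheet_smul_stepFun]

variable {b₀ : ClassifyingSpace G} {s : ClassifyingSpace G → FinProb (PathsFrom b₀)}
  {Φ : ClassifyingSpace G → IcoFun.Orbits G} {L : PathsFrom b₀ → IcoFun G}

theorem lowerSemicontinuous_mass_sheet (hs : Continuous[_, weakTopology _] s)
    (hsf : ∀ b, ∀ γ ∈ (s b).weights.support, endpoint b₀ γ = b)
    (hL : Continuous L) (hLΦ : ∀ γ, IcoFun.toOrbits G (L γ) = Φ (endpoint b₀ γ))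
    {k : SimplexCategory} (χ : (nerve (SingleObj G)).obj (op k))
    (hΦ : ∀ t, Φ (characteristicMap _ χ t) = IcoFun.toOrbits G (stepFun (labels χ) t)) (g : G) :
    LowerSemicontinuous fun t : stdSimplex ℝ (Fin (k.len + 1)) =>
      mass (s (characteristicMap _ χ t)) {γ | sheet (L γ) (labels χ) t = g} := by
  have key : ∀ t, ∀ γ ∈ (s (characteristicMap _ χ t)).weights.support,
      sheet (L γ) (labels χ) t • stepFun (labels χ) t = L γ := fun t γ hγ => by
    rw [← stepFun_smul]
    refine stepFun_sheet_smul ?_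
    rw [hLΦ, hsf _ γ hγ, hΦ]
  intro t₀ c hc
  set A : Set (PathsFrom b₀) := {γ | dist (L γ) (g • stepFun (labels χ) t₀) < 1 / 2}
  have hAo : IsOpen A := isOpen_lt (hL.dist continuous_const) continuous_const
  have hcA : c < mass (s (characteristicMap _ χ t₀)) A := by
    refine hc.trans_le (mass_mono_of_support fun γ hγ hg => ?_)
    have hg' : sheet (L γ) (labels χ) t₀ = g := hg
    change dist (L γ) _ < 1 / 2
    rw [← key t₀ γ hγ, hg', dist_self]
    norm_num
  have h1 := (continuous_weak_iff.1 hs A hAo).comp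
    (characteristicMap (nerve (SingleObj G)) χ).continuous t₀ c hcA
  have h2 : ∀ᶠ t in 𝓝 t₀, dist (stepFun (labels χ) t) (stepFun (labels χ) t₀) < 1 / 2 :=
    Metric.tendsto_nhds.1 (continuous_stepFun (labels χ)).continuousAt _ (by norm_num)
  filter_upwards [h1, h2] with t ht1 ht2
  refine lt_of_lt_of_le ht1 (mass_mono_of_support fun γ hγ hγA => ?_)
  -- Distinct translates of a step function have distance `1`, so nearby lifts are on the same sheet.
  have hγA' : dist (L γ) (g • stepFun (labels χ) t₀) < 1 / 2 := hγA
  change sheet (L γ) (labels χ) t = g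
  set g' := sheet (L γ) (labels χ) t
  have hd : dist (g • stepFun (labels χ) t₀) (g • stepFun (labels χ) t) < 1 / 2 := by
    rwa [IcoFun.dist_smul_smul, dist_comm]
  have h3 : dist ((g⁻¹ * g') • stepFun (labels χ) t) (stepFun (labels χ) t) < 1 := by
    rw [← IcoFun.dist_smul_smul g, smul_smul, mul_inv_cancel_left, key t γ hγ]
    linarith [dist_triangle (L γ) (g • stepFun (labels χ) t₀) (g • stepFun (labels χ) t)]
  exact (inv_mul_eq_one.1 (IcoFun.eq_one_of_dist_smul_self_lt h3)).symm

end Rays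

open Opposite in
/-- For finite `G`, a section of `𝒫_n` over `BG` that is continuous for the weak topology can be
replaced by one that is continuous for the quotient topology. The paths in the support of the
measure over a point `b` are replaced by the rays to `b` in the same homotopy class, of which there are
only `|G|`; on each simplex the rays move continuously, and so do the masses of the classes. -/
theorem hasSection_quotientTopology_of_weakTopology {G : Type u} [Group G] [Finite G] {n : ℕ}
    {b₀ : ClassifyingSpace G} (h : HasSection (weakTopology _) n (endpoint b₀)) :
    HasSection (quotientTopology _) n (endpoint b₀) := by
  rw [hasSection_iff] at h ⊢
  obtain ⟨s, hs, hp⟩ := h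
  obtain ⟨Φ, hΦc, hΦ⟩ := exists_classifyingMap G
  obtain ⟨e₀, he₀⟩ := IcoFun.isQuotientCoveringMap_toOrbits.surjective (Φ b₀)
  obtain ⟨L, hL, hLΦ⟩ := exists_continuous_lift_endpoint
    IcoFun.isQuotientCoveringMap_toOrbits.isCoveringMap hΦc b₀ he₀
  let α : Path b₀ (classifyingSpaceVertex G) := (joined_classifyingSpaceVertex b₀).symm.somePath
  have hstep : ∀ (k : SimplexCategory) (χ : (nerve (SingleObj G)).obj (op k)) t,
      ∀ γ ∈ (s (characteristicMap _ χ t)).weights.support,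
        stepFun (sheet (L γ) (labels χ) t • labels χ) t = L γ := by
    intro k χ t γ hγ
    refine stepFun_sheet_smul ?_
    rw [hLΦ, (hp _).2 γ hγ, hΦ]
  let φ : ∀ k : SimplexCategory, (nerve (SingleObj G)).obj (op k) →
      stdSimplex ℝ (Fin (k.len + 1)) → FinProb (PathsFrom b₀) := fun k χ t =>
    Convexity.StdSimplex.map (fun γ => ray α (sheet (L γ) (labels χ) t • labels χ) t)
      (s (characteristicMap _ χ t))
  have hcont : ∀ k χ, Continuous[_, quotientTopology _] (φ k χ) := by
    intro k χ
    obtain ⟨N, ⟨e⟩⟩ := Finite.exists_equiv_fin G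
    have : CompactSpace (stdSimplex ℝ (Fin (k.len + 1))) :=
      isCompact_iff_compactSpace.1 (isCompact_stdSimplex ℝ _)
    have hmap : φ k χ = fun t => combination (fun i => ray α (e.symm i • labels χ) t,
        fiberMasses (fun γ => e (sheet (L γ) (labels χ) t)) (s (characteristicMap _ χ t))) := by
      funext t
      rw [← map_eq_combination]
      simp only [Equiv.symm_apply_apply]
      rfl
    rw [hmap]
    refine continuous_combination ((continuous_pi fun i => continuous_ray α _).prodMk
      (Continuous.subtype_mk (continuous_pi ?_) _))
    refine continuous_of_lowerSemicontinuous_of_sum_eq (fun i => ?_) fun t => sum_mass_fibers _ _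
    have := lowerSemicontinuous_mass_sheet hs (fun b => (hp b).2) hL hLΦ χ (hΦ k χ) (e.symm i)
    convert this using 3 with t
    ext γ
    simp [Equiv.eq_symm_apply]
  have hnat : ∀ (m k : SimplexCategory) (θ : m ⟶ k) (χ : (nerve (SingleObj G)).obj (op k)) t,
      φ m ((nerve (SingleObj G)).map θ.op χ) t = φ k χ (stdSimplex.map θ t) := by
    intro m k θ χ t
    simp only [φ, characteristicMap_map]
    refine map_congr_of_support fun γ hγ => ?_
    have h1 := hstep k χ (stdSimplex.map θ t) γ hγ
    have h2 := hstep m ((nerve (SingleObj G)).map θ.op χ) t γ (by rwa [characteristicMap_map])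
    have hs1 := stepFun_map θ.toOrderHom (sheet (L γ) (labels χ) (stdSimplex.map θ t) • labels χ) t
    refine Eq.trans ?_ (ray_map α θ.toOrderHom _ t).symm
    obtain ⟨g, hg⟩ := exists_labels_map_eq_smul θ χ
    rw [hg, smul_smul] at h2 ⊢
    exact congrArg (fun v => ray α v t)
      (smul_eq_of_stepFun_eq (g' := sheet (L γ) (labels χ) (stdSimplex.map θ t))
        (h2.trans (h1.symm.trans hs1)))
  obtain ⟨F, hF, hFφ⟩ := exists_continuous_realization (nerve (SingleObj G)) (quotientTopology _) φ
    hcont hnat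
  refine ⟨F, hF, fun b => ?_⟩
  obtain ⟨k, χ, t, rfl⟩ := exists_characteristicMap_eq _ b
  rw [hFφ]
  refine ⟨(card_support_map_le _ _).trans (hp _).1, fun γ' hγ' => ?_⟩
  obtain ⟨γ, -, rfl⟩ := exists_of_mem_support_map hγ'
  exact (PathsFrom.endpoint_ofPath _).trans (characteristicMap_eq_labeledPoint k χ t _).symm

end

end AnalogCategory

open AnalogCategory in
/-- Weak sections connect both sides. The homotopy equivalence is used in both directions, with
different base points, so `BG` and `X` have to be path-connected. -/
theorem hasSection_iff_hasSection {G : Type*} [Group G] [Finite G] (n : ℕ)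
    (b₀ : ClassifyingSpace G) {X : Type*} [MetricSpace X]
    (e : ContinuousMap.HomotopyEquiv X (ClassifyingSpace G)) (x₀ : X) :
    HasSection (quotientTopology _) n (endpoint b₀) ↔
      HasSection (levyProkhorovTopology _) n (endpoint x₀) := by
  have hb (b b' : ClassifyingSpace G) : Joined b b' :=
    (joined_classifyingSpaceVertex b).symm.trans (joined_classifyingSpaceVertex b')
  obtain ⟨H⟩ := e.left_inv
  obtain ⟨H'⟩ := e.right_inv
  rw [levyProkhorovTopology_eq_weakTopology]
  constructor
  · intro h
    have hx : Joined x₀ (e.invFun b₀) :=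
      Joined.trans ⟨(H.evalAt x₀).symm⟩ ((hb (e.toFun x₀) b₀).map e.invFun.continuous)
    exact hasSection_weakTopology_of_homotopy e.toFun e.invFun H hx
      (h.mono (quotientTopology_le_weakTopology _))
  · intro h
    exact hasSection_quotientTopology_of_weakTopology
      (hasSection_weakTopology_of_homotopy e.invFun e.toFun H' (hb _ _) h)

theorem theorem1p3 {G : Type*} [Group G] [Finite G]
    (b₀ : AnalogCategory.ClassifyingSpace G)
    {X : Type*} [MetricSpace X]
    (hX : Nonempty (ContinuousMap.HomotopyEquiv X (AnalogCategory.ClassifyingSpace G))) (x₀ : X) :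
    AnalogCategory.acat (AnalogCategory.ClassifyingSpace G) b₀ = AnalogCategory.dcat X x₀ := by
  obtain ⟨e⟩ := hX
  unfold AnalogCategory.acat AnalogCategory.dcat AnalogCategory.analogSectionalCategory
    AnalogCategory.distributionalSectionalCategory AnalogCategory.sectionalCategory
  simp only [hasSection_iff_hasSection _ b₀ e x₀]
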